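/- Let $(M,\omega)$ be a symplectic manifold with a smooth symplectic left action $\Phi_g(x)=g\cdot x$ of a Lie group $G$ with Lie algebra $\mathfrak g$. Let $C^\infty(M)$ be the smooth complex-valued functions, let $\{u,v\}=\omega(X_u,X_v)=X_uv$ be the Poisson bracket, where $\omega(X_u,\cdot)=-du$ for real $u$, extended $\mathbb C$-bilinearly. For $\xi\in\mathfrak g$ let $\hat\xi(x)=\frac{d}{dt}\big|_{t=0}\exp(-t\xi)\cdot x$. A *star product* on $M$ is an associative $\mathbb C[[\hbar]]$-bilinear product on $C^\infty(M)[[\hbar]]$ of the form $f*_\hbar g=\sum_{k\ge0}\hbar^kC_k(f,g)$ for $f,g\in C^\infty(M)$, where $C_0(f,g)=fg$, $C_1(f,g)=-\frac i2\{f,g\}$, each $C_k$ is a bidifferential operator, $C_k(f,g)=(-1)^kC_k(g,f)$, and $C_k(1,f)=C_k(f,1)=0$ for $k\ge1$. It is *$G$-equivariant* if $\Phi_g^*(u*_\hbar v)=\Phi_g^*u*_\hbar\Phi_g^*v$ for all $g\in G$ and $u,v\in C^\infty(M)[[\hbar]]$. Let $\mathfrak g_\hbar$ be the Lie algebra $\mathfrak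 g_{\mathbb C}[[\hbar]]$ over $\mathbb C[[\hbar]]$ with bracket $[X,Y]_\hbar=-i\hbar[X,Y]$, and $U(\mathfrak g_\hbar)$ its universal enveloping algebra. A *quantum momentum map* is a homomorphism of unital associative $\mathbb C[[\hbar]]$-algebras $\mu_\hbar:U(\mathfrak g_\hbar)\to(C^\infty(M)[[\hbar]],*_\hbar)$ with $\hat\xi v=\frac i\hbar[\mu_\hbar(\xi),v]_{*_\hbar}$ for all $\xi\in\mathfrak g$ and $v\in C^\infty(M)[[\hbar]]$. Complex polynomials $f\in\mathrm{pol}(\mathfrak g^*)$ are regarded as elements of $U(\mathfrak g_\hbar)$ by symmetrization: $l_{\xi_1}\cdots l_{\xi_k}\mapsto\frac1{k!}\sum_{\sigma\in S_k}\xi_{\sigma(1)}\cdots\xi_{\sigma(k)}$, where $l_\xi(\alpha)=\langle\alpha,\xi\rangle$. **Proposition.** Suppose that $*_\hbar$ is a $G$-equivariant star product on $M$ and that $\mu_\hbar$ is a quantum momentum map. Then the action admits an equivariant classical momentum map: there is a smooth $J:M\to\mathfrak g^*$ such that, with $J_\xi=\langle J,\xi\rangle$, for all $\xi,\eta\in\mathfrak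 g$ $$\hat\xi=X_{J_\xi},\qquad \{J_\xi,J_\eta\}=J_{[\xi,\eta]},$$ and $\langle J(g\cdot x),\xi\rangle=\langle J(x),\mathrm{Ad}_{g^{-1}}\xi\rangle$ for all $x\in M$, $\xi\in\mathfrak g$ and all $g$ in the identity component of $G$ (hence for all $g\in G$ if $G$ is connected). Moreover, there is a locally constant map $c:M\to\mathfrak g^*$ with $c(x)|_{[\mathfrak g,\mathfrak g]}=0$ for all $x\in M$ such that, for this $J$, $$\mu_\hbar f=(J+ic)^*f+O(\hbar)\qquad\text{for all } f\in\mathrm{pol}(\mathfrak g^*),$$ where $f$ is extended to a complex polynomial on $\mathfrak g^*\otimes\mathbb C$. If the $\hbar^0$-term of $\mu_\hbar(\xi)$ is real-valued for every $\xi\in\mathfrak g$, then $c=0$, that is, $\mu_\hbar f=J^*f+O(\hbar)$ for all $f\in\mathrm{pol}(\mathfrak g^*)$. -/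

import Mathlib

open scoped Manifold ContDiff TensorProduct Topology

noncomputable section

namespace QuantumMomentum

/-! ### Smooth complex functions and symplectic forms -/

section Manifold

variable (E : Type*) [NormedAddCommGroup E] [NormedSpace ℝ E]
  (M : Type*) [TopologicalSpace M] [ChartedSpace E M]

instance : ContMDiffRing 𝓘(ℝ, ℂ) ∞ ℂ where
  contMDiff_mul := by
    rw [contMDiff_iff]
    refine ⟨continuous_mul, fun x y => ?_⟩
    simp only [mfld_simps, chartAt_self_eq]
    rw [contDiffOn_univ]
    exact contDiff_mul

/-- `C^∞(M)`, the commutative ring of smooth complex-valued functions on `M`. -/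
abbrev Smooth := ContMDiffMap 𝓘(ℝ, E) 𝓘(ℝ, ℂ) M ℂ ∞

/-- The embedding of `ℂ` in `C^∞(M)` as constant functions. -/
def constRingHom : ℂ →+* Smooth E M where
  toFun c := ⟨fun _ => c, contMDiff_const⟩
  map_one' := rfl
  map_mul' _ _ := rfl
  map_zero' := rfl
  map_add' _ _ := rfl

/-- `C^∞(M)` as a complex algebra. -/
instance smoothAlgebra : Algebra ℂ (Smooth E M) := (constRingHom E M).toAlgebra

/-- A symplectic form: a smooth, closed, nondegenerate 2-form. Smoothness and closedness are
expressed in the coordinate charts. -/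
structure SymplecticForm where
  /-- the value of the form at a point -/
  toForm : ∀ x : M, TangentSpace 𝓘(ℝ, E) x [⋀^Fin 2]→L[ℝ] ℝ
  /-- the coordinate expression in each chart is smooth -/
  smooth : ∀ x₀ : M, ContDiffOn ℝ ∞
    (fun y : E => (toForm ((extChartAt 𝓘(ℝ, E) x₀).symm y)).compContinuousLinearMap
      (mfderiv 𝓘(ℝ, E) 𝓘(ℝ, E) (extChartAt 𝓘(ℝ, E) x₀).symm y) : E → E [⋀^Fin 2]→L[ℝ] ℝ)
    (extChartAt 𝓘(ℝ, E) x₀).target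
  /-- the exterior derivative of the coordinate expression vanishes -/
  closed : ∀ x₀ : M, ∀ z ∈ (extChartAt 𝓘(ℝ, E) x₀).target,
    extDeriv
      (fun y : E => (toForm ((extChartAt 𝓘(ℝ, E) x₀).symm y)).compContinuousLinearMap
        (mfderiv 𝓘(ℝ, E) 𝓘(ℝ, E) (extChartAt 𝓘(ℝ, E) x₀).symm y) : E → E [⋀^Fin 2]→L[ℝ] ℝ) z = 0
  /-- nondegeneracy -/
  nondegenerate : ∀ (x : M) (v : TangentSpace 𝓘(ℝ, E) x),
    (∀ w : TangentSpace 𝓘(ℝ, E) x, toForm x ![v, w] = 0) → v = 0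

variable {E M}

/-- The differential of a real function, as a linear form on the tangent space. -/
def dReal (u : M → ℝ) (x : M) : TangentSpace 𝓘(ℝ, E) x →L[ℝ] ℝ :=
  mfderiv 𝓘(ℝ, E) 𝓘(ℝ, ℝ) u x

/-- The differential of a complex function, as a real-linear map from the tangent space. -/
def dComplex (f : M → ℂ) (x : M) : TangentSpace 𝓘(ℝ, E) x →L[ℝ] ℂ :=
  mfderiv 𝓘(ℝ, E) 𝓘(ℝ, ℂ) f x

namespace SymplecticForm

variable (Ω : SymplecticForm E M)

theorem update_pair {V : Type*} (v w z : V) : Function.update ![v, w] 1 z = ![v, z] := by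
  ext i
  fin_cases i <;> simp

/-- The map `v ↦ Ω(v, ·)` from the tangent space to its dual. -/
def flat (x : M) : TangentSpace 𝓘(ℝ, E) x →ₗ[ℝ] Module.Dual ℝ (TangentSpace 𝓘(ℝ, E) x) :=
  LinearMap.mk₂ ℝ (fun v w => Ω.toForm x ![v, w])
    (fun v v' w => by
      simpa using (Ω.toForm x).toAlternatingMap.map_vecCons_add ![w] v v')
    (fun c v w => by
      simpa using (Ω.toForm x).toAlternatingMap.map_vecCons_smul ![w] c v)
    (fun v w w' => by
      have h := (Ω.toForm x).toAlternatingMap.map_update_add ![v, w] 1 w w'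
      simp only [update_pair] at h
      exact h)
    (fun c v w => by
      have h := (Ω.toForm x).toAlternatingMap.map_update_smul ![v, w] 1 c w
      simp only [update_pair] at h
      exact h)

theorem flat_apply (x : M) (v w : TangentSpace 𝓘(ℝ, E) x) :
    Ω.flat x v w = Ω.toForm x ![v, w] := rfl

theorem flat_injective (x : M) : Function.Injective (Ω.flat x) := by
  rw [injective_iff_map_eq_zero]
  intro v hv
  exact Ω.nondegenerate x v fun w => by rw [← Ω.flat_apply, hv]; rfl

variable [FiniteDimensional ℝ E]

instance (x : M) : FiniteDimensional ℝ (TangentSpace 𝓘(ℝ, E) x) :=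
  inferInstanceAs (FiniteDimensional ℝ E)

/-- The isomorphism `v ↦ Ω(v, ·)` between the tangent space and its dual. -/
def flatEquiv (x : M) :
    TangentSpace 𝓘(ℝ, E) x ≃ₗ[ℝ] Module.Dual ℝ (TangentSpace 𝓘(ℝ, E) x) :=
  LinearEquiv.ofInjectiveOfFinrankEq (Ω.flat x) (Ω.flat_injective x)
    Subspace.dual_finrank_eq.symm

/-- The Hamiltonian vector field `X_u` of a real function `u`, with the sign convention
`Ω(X_u, ·) = -du`, so that `X_u = {u, ·}` for the bracket below. -/
def hamVec (u : M → ℝ) (x : M) : TangentSpace 𝓘(ℝ, E) x :=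
  (Ω.flatEquiv x).symm (-(dReal u x : TangentSpace 𝓘(ℝ, E) x →L[ℝ] ℝ).toLinearMap)

theorem toForm_hamVec (u : M → ℝ) (x : M) (w : TangentSpace 𝓘(ℝ, E) x) :
    Ω.toForm x ![Ω.hamVec u x, w] = -(dReal u x w) := by
  have h : Ω.flatEquiv x (Ω.hamVec u x) =
      -(dReal u x : TangentSpace 𝓘(ℝ, E) x →L[ℝ] ℝ).toLinearMap := by
    simp [hamVec]
  exact LinearMap.congr_fun h w

/-- The Poisson bracket `{u, v} = Ω(X_u, X_v) = X_u v` of real functions; for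
`Ω = dq ∧ dp` one has `{q, p} = 1`. -/
def poissonReal (u v : M → ℝ) (x : M) : ℝ := dReal v x (Ω.hamVec u x)

/-- The complex bilinear extension of the Poisson bracket to complex functions. -/
def poisson (f g : M → ℂ) (x : M) : ℂ :=
  dComplex g x (Ω.hamVec (fun y => (f y).re) x) +
    Complex.I * dComplex g x (Ω.hamVec (fun y => (f y).im) x)

end SymplecticForm

/-! ### Star products -/

variable [FiniteDimensional ℝ E]

/-- The iterated partial derivative `∂_{i₁} ⋯ ∂_{i_k} f` at `x`, in the coordinates given by the
preferred chart at `x₀`. -/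
def partialDeriv (x₀ : M) {k : ℕ} (i : Fin k → Fin (Module.finrank ℝ E)) (f : M → ℂ) (x : M) : ℂ :=
  iteratedFDeriv ℝ k (f ∘ (extChartAt 𝓘(ℝ, E) x₀).symm) (extChartAt 𝓘(ℝ, E) x₀ x)
    (fun j => Module.finBasis ℝ E (i j))

/-- `B` is a bidifferential operator: around every point, in coordinates, it is a finite sum
`B(f, g) = ∑ a_{p q} (∂_p f) (∂_q g)` with smooth coefficients. (The order is not required to be
bounded globally on `M`, which only makes the notion more general.) -/
def IsBidifferential (B : Smooth E M → Smooth E M → Smooth E M) : Prop :=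
  ∀ x₀ : M, ∃ U : Set M, IsOpen U ∧ x₀ ∈ U ∧ U ⊆ (chartAt E x₀).source ∧
    ∃ (N : ℕ)
      (a : (Σ k : Fin (N + 1), (Fin (k : ℕ) → Fin (Module.finrank ℝ E))) →
        (Σ k : Fin (N + 1), (Fin (k : ℕ) → Fin (Module.finrank ℝ E))) → M → ℂ),
      (∀ p q, ContMDiffOn 𝓘(ℝ, E) 𝓘(ℝ, ℂ) ∞ (a p q) U) ∧
      ∀ (f g : Smooth E M), ∀ x ∈ U,
        B f g x = ∑ p, ∑ q, a p q x * partialDeriv x₀ p.2 f x * partialDeriv x₀ q.2 g x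

/-- The `ħ`-bilinear extension to `C^∞(M)[[ħ]]` of `f * g = ∑_k ħ^k C_k(f, g)`. -/
def starMul (C : ℕ → Smooth E M →ₗ[ℂ] Smooth E M →ₗ[ℂ] Smooth E M)
    (u v : PowerSeries (Smooth E M)) : PowerSeries (Smooth E M) :=
  PowerSeries.mk fun n => ∑ p ∈ Finset.HasAntidiagonal.antidiagonal n, ∑ q ∈ Finset.HasAntidiagonal.antidiagonal p.2,
    C p.1 (PowerSeries.coeff q.1 u) (PowerSeries.coeff q.2 v)

/-- A star product on the symplectic manifold `(M, Ω)`: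
`f * g = f g - (iħ/2) {f, g} + ⋯ + ħ^k C_k(f, g) + ⋯`. -/
structure StarProduct (Ω : SymplecticForm E M) where
  /-- the coefficients of the product -/
  C : ℕ → Smooth E M →ₗ[ℂ] Smooth E M →ₗ[ℂ] Smooth E M
  C_zero : ∀ f g, C 0 f g = f * g
  C_one : ∀ (f g : Smooth E M) (x : M), C 1 f g x = -(Complex.I / 2) * Ω.poisson f g x
  C_symm : ∀ k f g, C k f g = (-1) ^ k * C k g f
  C_unit_left : ∀ k, 1 ≤ k → ∀ f, C k 1 f = 0
  C_unit_right : ∀ k, 1 ≤ k → ∀ f, C k f 1 = 0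
  bidifferential : ∀ k, IsBidifferential fun f g => C k f g
  assoc : ∀ u v w, starMul C (starMul C u v) w = starMul C u (starMul C v w)

namespace StarProduct

variable {Ω : SymplecticForm E M} (S : StarProduct Ω)

/-- The product of `C^∞(M)[[ħ]]`. -/
def mul (u v : PowerSeries (Smooth E M)) : PowerSeries (Smooth E M) := starMul S.C u v

/-- `(i/ħ) [a, v]`. The commutator is divisible by `ħ` because `C_0` is commutative, so division
by `ħ` is the shift of coefficients. -/
def adIOverHbar (a v : PowerSeries (Smooth E M)) : PowerSeries (Smooth E M) :=
  PowerSeries.mk fun n =>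
    Complex.I • PowerSeries.coeff (n + 1) (S.mul a v - S.mul v a)

theorem constantCoeff_commutator (a v : PowerSeries (Smooth E M)) :
    PowerSeries.coeff 0 (S.mul a v - S.mul v a) = 0 := by
  simp [mul, starMul, S.C_zero, mul_comm]

end StarProduct

end Manifold

/-! ### Lie group actions -/

section Action

variable {E : Type*} [NormedAddCommGroup E] [NormedSpace ℝ E]
  {M : Type*} [TopologicalSpace M] [ChartedSpace E M]
  {F : Type*} [NormedAddCommGroup F] [NormedSpace ℝ F]
  {G : Type*} [TopologicalSpace G] [ChartedSpace F G] [Group G]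

instance [LieGroup 𝓘(ℝ, F) ∞ G] : LieGroup 𝓘(ℝ, F) (minSmoothness ℝ 3) G := by
  rw [minSmoothness_of_isRCLikeNormedField]
  infer_instance

variable [MulAction G M]

/-- The action of every `g ∈ G` preserves `Ω`. -/
def IsSymplecticAction (G : Type*) [Group G] [MulAction G M] (Ω : SymplecticForm E M) : Prop :=
  ∀ (g : G) (x : M), (Ω.toForm (g • x)).compContinuousLinearMap
    (mfderiv 𝓘(ℝ, E) 𝓘(ℝ, E) (fun y : M => g • y) x) = Ω.toForm x

/-- The vector field `ξ̂` of the infinitesimal action,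
`ξ̂(x) = d/dt exp(-tξ) x` at `t = 0`; with this sign, `ξ ↦ ξ̂` is a homomorphism of Lie
algebras. -/
def infVec (ξ : GroupLieAlgebra 𝓘(ℝ, F) G) (x : M) : TangentSpace 𝓘(ℝ, E) x :=
  -(mfderiv 𝓘(ℝ, F) 𝓘(ℝ, E) (fun g : G => g • x) 1 ξ : E)

/-- The adjoint action of `G` on its Lie algebra. -/
def Ad (g : G) (ξ : GroupLieAlgebra 𝓘(ℝ, F) G) : GroupLieAlgebra 𝓘(ℝ, F) G :=
  (mfderiv 𝓘(ℝ, F) 𝓘(ℝ, F) (fun h : G => g * h * g⁻¹) 1 ξ : F)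

/-- The pullback `Φ_g^* f = f ∘ Φ_g`, where `Φ_g x = g • x`. -/
def pullback [ContMDiffSMul 𝓘(ℝ, F) 𝓘(ℝ, E) ∞ G M] (g : G) (f : Smooth E M) : Smooth E M :=
  ⟨fun x => f (g • x), f.contMDiff.comp
    ((contMDiff_smul (I := 𝓘(ℝ, F)) (I' := 𝓘(ℝ, E)) (n := ∞) (G := G) (M := M)).comp
      (contMDiff_const.prodMk contMDiff_id))⟩

/-- The pullback `Φ_g^*` on `C^∞(M)[[ħ]]`. -/
def pullbackSeries [ContMDiffSMul 𝓘(ℝ, F) 𝓘(ℝ, E) ∞ G M] (g : G)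
    (u : PowerSeries (Smooth E M)) : PowerSeries (Smooth E M) :=
  PowerSeries.mk fun n => pullback (F := F) g (PowerSeries.coeff n u)

variable [FiniteDimensional ℝ E]

/-- The star product is `G`-equivariant. -/
def IsEquivariantStar (F : Type*) [NormedAddCommGroup F] [NormedSpace ℝ F]
    (G : Type*) [TopologicalSpace G] [ChartedSpace F G] [Group G] [MulAction G M]
    [ContMDiffSMul 𝓘(ℝ, F) 𝓘(ℝ, E) ∞ G M] {Ω : SymplecticForm E M} (S : StarProduct Ω) : Prop :=
  ∀ (g : G) (u v : PowerSeries (Smooth E M)),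
    pullbackSeries (F := F) g (S.mul u v) =
      S.mul (pullbackSeries (F := F) g u) (pullbackSeries (F := F) g v)

/-- `J : M → 𝔤^*` is a (classical) momentum map: it is smooth, and for every `ξ ∈ 𝔤` the vector
field `ξ̂` is the Hamiltonian vector field of `J_ξ = ⟨J, ξ⟩`. -/
structure IsMomentumMap (Ω : SymplecticForm E M)
    (J : M → (GroupLieAlgebra 𝓘(ℝ, F) G →L[ℝ] ℝ)) : Prop where
  smooth : ∀ ξ : GroupLieAlgebra 𝓘(ℝ, F) G, ContMDiff 𝓘(ℝ, E) 𝓘(ℝ, ℝ) ∞ fun x => J x ξ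
  hamiltonian : ∀ (ξ : GroupLieAlgebra 𝓘(ℝ, F) G) (x : M),
    infVec ξ x = Ω.hamVec (fun y => J y ξ) x

/-- `J` is equivariant: infinitesimally, i.e. `{J_ξ, J_η} = J_{[ξ, η]}`, and under the identity
component of `G`, i.e. `J(g x) = Ad^*_g J(x)`. When `G` is connected the latter is equivariance
under all of `G`. -/
structure IsEquivariantMap [LieGroup 𝓘(ℝ, F) ∞ G] [FiniteDimensional ℝ F]
    (Ω : SymplecticForm E M)
    (J : M → (GroupLieAlgebra 𝓘(ℝ, F) G →L[ℝ] ℝ)) : Prop where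
  infinitesimal : ∀ (ξ η : GroupLieAlgebra 𝓘(ℝ, F) G) (x : M),
    Ω.poissonReal (fun y => J y ξ) (fun y => J y η) x = J x ⁅ξ, η⁆
  coadjoint : ∀ g ∈ connectedComponent (1 : G), ∀ (x : M) (ξ : GroupLieAlgebra 𝓘(ℝ, F) G),
    J (g • x) ξ = J x (Ad g⁻¹ ξ)

end Action

/-! ### The deformed Lie algebra and its enveloping algebra -/

section Deformed

variable (L : Type*) [LieRing L] [LieAlgebra ℝ L]

/-- The deformed Lie algebra `𝔤_ħ` over `ℂ[[ħ]]`: the module `ℂ[[ħ]] ⊗ 𝔤` (which is `𝔤_ℂ[[ħ]]` for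
finite-dimensional `𝔤`), with bracket `[X, Y]_ħ = -iħ [X, Y]`. -/
def Deformed := PowerSeries ℂ ⊗[ℝ] L

instance : AddCommGroup (Deformed L) := inferInstanceAs (AddCommGroup (PowerSeries ℂ ⊗[ℝ] L))

instance : Module (PowerSeries ℂ) (Deformed L) :=
  inferInstanceAs (Module (PowerSeries ℂ) (PowerSeries ℂ ⊗[ℝ] L))

/-- The inclusion of `𝔤` in `𝔤_ħ`. -/
def Deformed.of (ξ : L) : Deformed L := (1 : PowerSeries ℂ) ⊗ₜ[ℝ] ξ

variable {L} in
/-- The undeformed, `ℂ[[ħ]]`-bilinear bracket on `ℂ[[ħ]] ⊗ 𝔤`. -/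
def Deformed.undeformedBracket (x y : Deformed L) : Deformed L :=
  (⁅(show PowerSeries ℂ ⊗[ℝ] L from x), (show PowerSeries ℂ ⊗[ℝ] L from y)⁆ :
    PowerSeries ℂ ⊗[ℝ] L)

instance : Bracket (Deformed L) (Deformed L) where
  bracket x y := (PowerSeries.C (-Complex.I) * PowerSeries.X : PowerSeries ℂ) •
    Deformed.undeformedBracket x y

theorem Deformed.bracket_def (x y : Deformed L) :
    ⁅x, y⁆ = (PowerSeries.C (-Complex.I) * PowerSeries.X : PowerSeries ℂ) •
      Deformed.undeformedBracket x y := rfl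

instance : LieRing (Deformed L) where
  add_lie x y z := by
    simp only [Deformed.bracket_def]
    rw [← smul_add]
    exact congrArg _ (add_lie (L := PowerSeries ℂ ⊗[ℝ] L) (M := PowerSeries ℂ ⊗[ℝ] L) x y z)
  lie_add x y z := by
    simp only [Deformed.bracket_def]
    rw [← smul_add]
    exact congrArg _ (lie_add (L := PowerSeries ℂ ⊗[ℝ] L) (M := PowerSeries ℂ ⊗[ℝ] L) x y z)
  lie_self x := by
    rw [Deformed.bracket_def]
    have h : Deformed.undeformedBracket x x = 0 := lie_self (L := PowerSeries ℂ ⊗[ℝ] L) x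
    rw [h, smul_zero]
  leibniz_lie x y z := by
    simp only [Deformed.bracket_def]
    generalize (PowerSeries.C (-Complex.I) * PowerSeries.X : PowerSeries ℂ) = c
    have h1 : ∀ a b : Deformed L, Deformed.undeformedBracket a (c • b) =
        c • Deformed.undeformedBracket a b := fun a b =>
      lie_smul (R := PowerSeries ℂ) (L := PowerSeries ℂ ⊗[ℝ] L) (M := PowerSeries ℂ ⊗[ℝ] L) c a b
    have h2 : ∀ a b : Deformed L, Deformed.undeformedBracket (c • a) b =
        c • Deformed.undeformedBracket a b := fun a b =>
      smul_lie (R := PowerSeries ℂ) (L := PowerSeries ℂ ⊗[ℝ] L) (M := PowerSeries ℂ ⊗[ℝ] L) c a b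
    have h3 : Deformed.undeformedBracket x (Deformed.undeformedBracket y z) =
        Deformed.undeformedBracket (Deformed.undeformedBracket x y) z +
        Deformed.undeformedBracket y (Deformed.undeformedBracket x z) :=
      LieRing.leibniz_lie (L := PowerSeries ℂ ⊗[ℝ] L) x y z
    rw [h1, h1, h2, h3, smul_add, smul_add]

instance : LieAlgebra (PowerSeries ℂ) (Deformed L) where
  lie_smul t x y := by
    simp only [Deformed.bracket_def]
    have h : Deformed.undeformedBracket x (t • y) = t • Deformed.undeformedBracket x y :=
      lie_smul (R := PowerSeries ℂ) (L := PowerSeries ℂ ⊗[ℝ] L) (M := PowerSeries ℂ ⊗[ℝ] L) t x y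
    rw [h, smul_comm]

/-- `U(𝔤_ħ)`, the universal enveloping algebra over `ℂ[[ħ]]` of the deformed Lie algebra. -/
abbrev EnvHbar := UniversalEnvelopingAlgebra (PowerSeries ℂ) (Deformed L)

variable {L}

/-- The element of `U(𝔤_ħ)` given by `ξ ∈ 𝔤`. -/
def genU (ξ : L) : EnvHbar L :=
  UniversalEnvelopingAlgebra.ι (PowerSeries ℂ) (Deformed.of L ξ)

/-- The symmetrized product `(1/k!) ∑_σ a_{σ 1} ⋯ a_{σ k}`. -/
def symProd {k : ℕ} (a : Fin k → EnvHbar L) : EnvHbar L :=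
  (PowerSeries.C ((k.factorial : ℂ)⁻¹) : PowerSeries ℂ) •
    ∑ σ : Equiv.Perm (Fin k), (List.ofFn fun j => a (σ j)).prod

/-- The symmetrization map `pol(𝔤^*) → U(𝔤_ħ)`. A basis `b` of `𝔤` identifies `pol(𝔤^*)` with
polynomials in the linear coordinates `l_{b i}`; a monomial `l_{b i₁} ⋯ l_{b i_k}` goes to the
symmetrized product of `b i₁, …, b i_k`. -/
def symmetrize {n : ℕ} (b : Module.Basis (Fin n) ℝ L) (f : MvPolynomial (Fin n) ℂ) : EnvHbar L :=
  ∑ α ∈ f.support, (PowerSeries.C (f.coeff α) : PowerSeries ℂ) •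
    symProd fun j : Fin (Finsupp.toMultiset α).toList.length =>
      genU (b ((Finsupp.toMultiset α).toList.get j))

end Deformed

/-! ### Quantum momentum maps -/

section Quantum

variable {E : Type*} [NormedAddCommGroup E] [NormedSpace ℝ E] [FiniteDimensional ℝ E]
  {M : Type*} [TopologicalSpace M] [ChartedSpace E M]
  {F : Type*} [NormedAddCommGroup F] [NormedSpace ℝ F] [FiniteDimensional ℝ F]
  {G : Type*} [TopologicalSpace G] [ChartedSpace F G] [Group G] [LieGroup 𝓘(ℝ, F) ∞ G]
  [MulAction G M]

/-- A quantum momentum map: a homomorphism of unital associative `ℂ[[ħ]]`-algebras from `U(𝔤_ħ)` to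
`C^∞(M)[[ħ]]` with the star product, such that `ξ̂ = ad((i/ħ) μ(ξ))` as derivations of
`C^∞(M)[[ħ]]` for all `ξ ∈ 𝔤`. -/
structure IsQuantumMomentumMap {Ω : SymplecticForm E M} (S : StarProduct Ω)
    (μ : EnvHbar (GroupLieAlgebra 𝓘(ℝ, F) G) →ₗ[PowerSeries ℂ] PowerSeries (Smooth E M)) :
    Prop where
  map_one : μ 1 = 1
  map_mul : ∀ a b, μ (a * b) = S.mul (μ a) (μ b)
  inner : ∀ (ξ : GroupLieAlgebra 𝓘(ℝ, F) G) (v : PowerSeries (Smooth E M)) (k : ℕ) (x : M),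
    dComplex (E := E) (PowerSeries.coeff k v : Smooth E M) x (infVec ξ x) =
      PowerSeries.coeff k (S.adIOverHbar (μ (genU ξ)) v) x

end Quantum

end QuantumMomentum

end

open QuantumMomentum

open scoped Manifold ContDiff TensorProduct Topology

/-!
Let `a_ξ` be the `ħ⁰`-term of `μ(ξ)`; the momentum map is `J_ξ = Re a_ξ`, the correction is
`c_ξ = Im a_ξ`.

Modulo `ħ` the star product is the pointwise product, and a commutator is `-iħ {·, ·} + O(ħ²)`
(`StarProduct.coeff_one_commutator`). Hence the lowest order of `ξ̂ = (i/ħ) ad μ(ξ)` says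
`ξ̂ f = {a_ξ, f}`, and the order `ħ` of `[μ(ξ), μ(η)] = -iħ μ([ξ, η])` says
`{a_ξ, a_η} = a_{[ξ, η]}`. The vector field `ξ̂` is real, so testing on real functions gives
`ξ̂ = X_{J_ξ}` and `X_{c_ξ} = 0`: the functions `c_ξ` have zero differential, so they are locally
constant, and the bracket relation is real, so `c` vanishes on brackets and
`{J_ξ, J_η} = J_{[ξ, η]}` (`IsQuantumMomentumMap.symbol_lie`).

Equivariance under the identity component needs no exponential map. The function
`g ↦ ⟨J(g x), Ad_g ξ⟩` has at the identity the derivative `-{J_v, J_ξ} + J_{[v, ξ]} = 0` along `v`,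
because the differential of `Ad` is `ad` (`hasFDerivAt_Ad`). Right translations carry this to
every point of `G`, so the function is locally constant (`IsMomentumMap.isEquivariantMap`).

Finally, `a ↦ μ(a)(x) mod ħ` is a character of `U(𝔤_ħ)`, and a character sends a symmetrized
product to the product of the values of its factors
(`IsQuantumMomentumMap.constantCoeff_symmetrize`).
-/

namespace QuantumMomentum

/-! ### Leading terms of star products -/

section StarProduct

variable {E : Type*} [NormedAddCommGroup E] [NormedSpace ℝ E]
  {M : Type*} [TopologicalSpace M] [ChartedSpace E M]

theorem smooth_smul_apply (c : ℂ) (f : Smooth E M) (x : M) : (c • f) x = c * f x := rfl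

theorem constantCoeff_smul (p : PowerSeries ℂ) (u : PowerSeries (Smooth E M)) (x : M) :
    PowerSeries.constantCoeff (p • u) x =
      PowerSeries.constantCoeff p * PowerSeries.constantCoeff u x := by
  rw [Algebra.smul_def, map_mul, PowerSeries.algebraMap_apply'']
  rfl

variable [FiniteDimensional ℝ E] {Ω : SymplecticForm E M}

theorem StarProduct.constantCoeff_mul (S : StarProduct Ω) (u v : PowerSeries (Smooth E M)) :
    PowerSeries.constantCoeff (S.mul u v) =
      PowerSeries.constantCoeff u * PowerSeries.constantCoeff v := by
  rw [← PowerSeries.coeff_zero_eq_constantCoeff_apply]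
  simp [StarProduct.mul, starMul, S.C_zero]

/-- The commutator of the star product is `-iħ {·, ·} + O(ħ²)`: at order `ħ` the pointwise products
cancel, and `C_1` is antisymmetric. -/
theorem StarProduct.coeff_one_commutator (S : StarProduct Ω) (u v : PowerSeries (Smooth E M))
    (x : M) :
    PowerSeries.coeff 1 (S.mul u v - S.mul v u) x =
      -Complex.I * Ω.poisson (PowerSeries.constantCoeff u : Smooth E M)
        (PowerSeries.constantCoeff v : Smooth E M) x := by
  have h : PowerSeries.coeff 1 (S.mul u v - S.mul v u) =
      S.C 1 (PowerSeries.constantCoeff u) (PowerSeries.constantCoeff v) +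
      S.C 1 (PowerSeries.constantCoeff u) (PowerSeries.constantCoeff v) := by
    have hs := S.C_symm 1 (PowerSeries.constantCoeff v) (PowerSeries.constantCoeff u)
    simp only [pow_one, neg_mul, one_mul] at hs
    simp only [StarProduct.mul, starMul, map_sub, PowerSeries.coeff_mk,
      Finset.Nat.sum_antidiagonal_eq_sum_range_succ_mk]
    simp only [Finset.sum_range_succ, Finset.sum_range_zero, zero_add, Nat.sub_zero,
      Nat.sub_self, hs, S.C_zero, PowerSeries.coeff_zero_eq_constantCoeff_apply]
    ring
  rw [h]
  change S.C 1 _ _ x + S.C 1 _ _ x = _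
  rw [S.C_one]
  ring

end StarProduct

section Quantum

variable {E : Type*} [NormedAddCommGroup E] [NormedSpace ℝ E]
  {M : Type*} [TopologicalSpace M] [ChartedSpace E M]
  {F : Type*} [NormedAddCommGroup F] [NormedSpace ℝ F] [FiniteDimensional ℝ F]
  {G : Type*} [TopologicalSpace G] [ChartedSpace F G] [Group G] [LieGroup 𝓘(ℝ, F) ∞ G]
  {μ : EnvHbar (GroupLieAlgebra 𝓘(ℝ, F) G) →ₗ[PowerSeries ℂ] PowerSeries (Smooth E M)}

/-- The `ħ⁰`-term of `μ(ξ)`. -/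
noncomputable def symbol
    (μ : EnvHbar (GroupLieAlgebra 𝓘(ℝ, F) G) →ₗ[PowerSeries ℂ] PowerSeries (Smooth E M))
    (ξ : GroupLieAlgebra 𝓘(ℝ, F) G) : Smooth E M :=
  PowerSeries.constantCoeff (μ (genU ξ))

theorem symbol_add (ξ η : GroupLieAlgebra 𝓘(ℝ, F) G) :
    symbol μ (ξ + η) = symbol μ ξ + symbol μ η := by
  simp only [symbol, genU, ← map_add]
  congr 3
  exact TensorProduct.tmul_add _ _ _

theorem symbol_smul (r : ℝ) (ξ : GroupLieAlgebra 𝓘(ℝ, F) G) (x : M) :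
    symbol μ (r • ξ) x = r * symbol μ ξ x := by
  have h : Deformed.of _ (r • ξ) = (PowerSeries.C (r : ℂ)) • Deformed.of _ ξ := by
    change (1 : PowerSeries ℂ) ⊗ₜ[ℝ] (r • ξ) = PowerSeries.C (r : ℂ) • (1 : PowerSeries ℂ) ⊗ₜ[ℝ] ξ
    rw [TensorProduct.tmul_smul, TensorProduct.smul_tmul', TensorProduct.smul_tmul']
    congr 1
    ext n
    simp [PowerSeries.coeff_C, PowerSeries.coeff_one]
  simp only [symbol, genU, h]
  let _ := LieRing.ofAssociativeRing (A := EnvHbar (GroupLieAlgebra 𝓘(ℝ, F) G))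
  rw [map_smul, map_smul, constantCoeff_smul, PowerSeries.constantCoeff_C]

variable [FiniteDimensional ℝ E] [MulAction G M] {Ω : SymplecticForm E M} {S : StarProduct Ω}

/-- The lowest order of `ξ̂ = (i/ħ) ad μ(ξ)`. -/
theorem IsQuantumMomentumMap.dComplex_infVec (hμ : IsQuantumMomentumMap S μ)
    (ξ : GroupLieAlgebra 𝓘(ℝ, F) G) (f : Smooth E M) (x : M) :
    dComplex (E := E) f x (infVec ξ x) = Ω.poisson (symbol μ ξ) f x := by
  have h := hμ.inner ξ (PowerSeries.C f) 0 x
  simp only [StarProduct.adIOverHbar, PowerSeries.coeff_mk, zero_add] at h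
  rw [smooth_smul_apply, S.coeff_one_commutator] at h
  simp only [PowerSeries.coeff_zero_eq_constantCoeff, PowerSeries.constantCoeff_C] at h
  rw [h, ← mul_assoc]
  simp [symbol]

/-- The coefficient of `ħ` in `[μ(ξ), μ(η)] = -iħ μ([ξ, η])`. -/
theorem IsQuantumMomentumMap.poisson_symbol (hμ : IsQuantumMomentumMap S μ)
    (ξ η : GroupLieAlgebra 𝓘(ℝ, F) G) (x : M) :
    Ω.poisson (symbol μ ξ) (symbol μ η) x = symbol μ ⁅ξ, η⁆ x := by
  have hbr : (genU ξ * genU η - genU η * genU ξ : EnvHbar (GroupLieAlgebra 𝓘(ℝ, F) G)) =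
      (PowerSeries.C (-Complex.I) * PowerSeries.X : PowerSeries ℂ) • genU ⁅ξ, η⁆ := by
    have h0 : Deformed.undeformedBracket (Deformed.of _ ξ) (Deformed.of _ η) =
        Deformed.of _ ⁅ξ, η⁆ := by
      simp only [Deformed.undeformedBracket, Deformed.of]
      rw [LieAlgebra.ExtendScalars.bracket_tmul, one_mul]
    let _ := LieRing.ofAssociativeRing (A := EnvHbar (GroupLieAlgebra 𝓘(ℝ, F) G))
    have h1 := LieHom.map_lie (UniversalEnvelopingAlgebra.ι (PowerSeries ℂ))
      (Deformed.of _ ξ) (Deformed.of _ η)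
    rw [Deformed.bracket_def, h0, map_smul, LieRing.of_associative_ring_bracket] at h1
    exact h1.symm
  have hX : PowerSeries.coeff 1 (PowerSeries.X * μ (genU ⁅ξ, η⁆)) = symbol μ ⁅ξ, η⁆ :=
    by simp [symbol]
  have h := congrArg (fun a => PowerSeries.coeff 1 (μ a) x) hbr
  simp only [map_sub μ, hμ.map_mul, map_smul μ] at h
  rw [S.coeff_one_commutator, mul_smul, Algebra.smul_def, PowerSeries.algebraMap_apply'',
    PowerSeries.map_C, PowerSeries.coeff_C_mul, Algebra.smul_def, PowerSeries.algebraMap_apply'',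
    PowerSeries.map_X, hX] at h
  have h' : -Complex.I * Ω.poisson (symbol μ ξ) (symbol μ η) x =
    -Complex.I * symbol μ ⁅ξ, η⁆ x := h
  exact mul_left_cancel₀ (neg_ne_zero.2 Complex.I_ne_zero) h'

/-- The classical limit at a point: `a ↦ μ(a)(x) mod ħ` is a character of `U(𝔤_ħ)`, because
the star product reduces to the pointwise product at `ħ = 0`. -/
noncomputable def IsQuantumMomentumMap.character (hμ : IsQuantumMomentumMap S μ) (x : M) :
    EnvHbar (GroupLieAlgebra 𝓘(ℝ, F) G) →+* ℂ where
  toFun a := PowerSeries.constantCoeff (μ a) x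
  map_one' := by rw [hμ.map_one, PowerSeries.constantCoeff_one]; rfl
  map_mul' a b := by rw [hμ.map_mul, S.constantCoeff_mul]; rfl
  map_zero' := by rw [map_zero, map_zero]; rfl
  map_add' a b := by rw [map_add, map_add]; rfl

theorem IsQuantumMomentumMap.character_smul (hμ : IsQuantumMomentumMap S μ) (x : M)
    (p : PowerSeries ℂ) (a : EnvHbar (GroupLieAlgebra 𝓘(ℝ, F) G)) :
    hμ.character x (p • a) = PowerSeries.constantCoeff p * hμ.character x a := by
  change PowerSeries.constantCoeff (μ (p • a)) x = _
  rw [map_smul, constantCoeff_smul]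
  rfl

/-- A character sees no ordering, so it sends the symmetrized product to the product. -/
theorem IsQuantumMomentumMap.character_symProd (hμ : IsQuantumMomentumMap S μ) (x : M) {k : ℕ}
    (a : Fin k → EnvHbar (GroupLieAlgebra 𝓘(ℝ, F) G)) :
    hμ.character x (symProd a) = ∏ j, hμ.character x (a j) := by
  have h (σ : Equiv.Perm (Fin k)) : hμ.character x (List.ofFn fun j => a (σ j)).prod =
      ∏ j, hμ.character x (a j) := by
    rw [map_list_prod, List.map_ofFn, List.prod_ofFn]
    exact Equiv.prod_comp σ fun j => hμ.character x (a j)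
  rw [symProd, hμ.character_smul, map_sum]
  simp only [h, Finset.sum_const, Finset.card_univ, Fintype.card_perm, Fintype.card_fin,
    PowerSeries.constantCoeff_C, nsmul_eq_mul]
  rw [← mul_assoc, inv_mul_cancel₀ (by exact_mod_cast k.factorial_ne_zero), one_mul]

theorem IsQuantumMomentumMap.constantCoeff_symmetrize (hμ : IsQuantumMomentumMap S μ) {n : ℕ}
    (b : Module.Basis (Fin n) ℝ (GroupLieAlgebra 𝓘(ℝ, F) G)) (f : MvPolynomial (Fin n) ℂ)
    (x : M) :
    PowerSeries.constantCoeff (μ (symmetrize b f)) x =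
      MvPolynomial.eval (fun i => symbol μ (b i) x) f := by
  change hμ.character x (symmetrize b f) = _
  rw [symmetrize, map_sum, MvPolynomial.eval_eq']
  refine Finset.sum_congr rfl fun α _ => ?_
  rw [hμ.character_smul, hμ.character_symProd, PowerSeries.constantCoeff_C]
  congr 1
  change ∏ j : Fin (Finsupp.toMultiset α).toList.length,
    (fun i => symbol μ (b i) x) ((Finsupp.toMultiset α).toList.get j) = _
  rw [← List.prod_ofFn]
  change (List.ofFn ((fun i => symbol μ (b i) x) ∘ (Finsupp.toMultiset α).toList.get)).prod = _
  rw [← List.map_ofFn, List.ofFn_get, ← Multiset.prod_coe,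
    ← Multiset.map_coe, Multiset.coe_toList, Finsupp.toMultiset_map, Finsupp.prod_toMultiset,
    Finsupp.prod_mapDomain_index (by simp) (by simp [pow_add]), Finsupp.prod_fintype _ _ (by simp)]

end Quantum

/-! ### Differentials of functions on a manifold -/

section Manifold

variable {E : Type*} [NormedAddCommGroup E] [NormedSpace ℝ E]
  {M : Type*} [TopologicalSpace M] [ChartedSpace E M]

/-- A function with zero differential is constant on every ball in a chart. -/
theorem isLocallyConstant_of_hasMFDerivAt_zero [IsManifold 𝓘(ℝ, E) 1 M]
    {V : Type*} [NormedAddCommGroup V] [NormedSpace ℝ V] {f : M → V}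
    (h : ∀ x, HasMFDerivAt 𝓘(ℝ, E) 𝓘(ℝ, V) f x (0 : E →L[ℝ] V)) : IsLocallyConstant f := by
  rw [IsLocallyConstant.iff_eventually_eq]
  intro x
  have hd (z : E) (hz : z ∈ (extChartAt 𝓘(ℝ, E) x).target) :
      HasFDerivAt (f ∘ (extChartAt 𝓘(ℝ, E) x).symm) (0 : E →L[ℝ] V) z := by
    have h1 := (mdifferentiableWithinAt_extChartAt_symm (I := 𝓘(ℝ, E)) hz)
    simp only [modelWithCornersSelf_coe, Set.range_id, mdifferentiableWithinAt_univ] at h1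
    have h2 := (h ((extChartAt 𝓘(ℝ, E) x).symm z)).comp z h1.hasMFDerivAt
    have h3 := h2.hasFDerivAt
    refine h3.congr_fderiv ?_
    exact ContinuousLinearMap.zero_comp _
  obtain ⟨r, hr, hball⟩ := Metric.isOpen_iff.1 (isOpen_extChartAt_target (I := 𝓘(ℝ, E)) x) _
    (mem_extChartAt_target x)
  filter_upwards [extChartAt_source_mem_nhds (I := 𝓘(ℝ, E)) x,
    (continuousAt_extChartAt (I := 𝓘(ℝ, E)) x) (Metric.ball_mem_nhds _ hr)] with y hy hyr
  have hc := (convex_ball (extChartAt 𝓘(ℝ, E) x x) r).is_const_of_fderivWithin_eq_zero (𝕜 := ℝ)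
    (f := f ∘ (extChartAt 𝓘(ℝ, E) x).symm)
    (fun z hz => (hd z (hball hz)).differentiableAt.differentiableWithinAt)
    (fun z hz => by
      rw [fderivWithin_of_isOpen Metric.isOpen_ball hz, (hd z (hball hz)).fderiv])
    hyr (Metric.mem_ball_self hr)
  rwa [Function.comp_apply, Function.comp_apply, extChartAt_to_inv,
    (extChartAt 𝓘(ℝ, E) x).left_inv hy] at hc

/-- Smooth functions separate tangent vectors: a linear form in a chart, cut off by a bump
function, detects any nonzero vector. -/
theorem tangent_eq_zero_of_dReal [FiniteDimensional ℝ E] [IsManifold 𝓘(ℝ, E) ∞ M] [T2Space M]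
    {x : M} {v : TangentSpace 𝓘(ℝ, E) x}
    (h : ∀ u : M → ℝ, ContMDiff 𝓘(ℝ, E) 𝓘(ℝ, ℝ) ∞ u → dReal u x v = 0) : v = 0 := by
  refine (Module.forall_dual_apply_eq_zero_iff ℝ (v : E)).1 fun ℓ => ?_
  let L : E →L[ℝ] ℝ := LinearMap.toContinuousLinearMap ℓ
  obtain ⟨f⟩ : Nonempty (SmoothBumpFunction 𝓘(ℝ, E) x) := inferInstance
  have hu : ContMDiff 𝓘(ℝ, E) 𝓘(ℝ, ℝ) ∞ fun y => f y • L (extChartAt 𝓘(ℝ, E) x y) :=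
    f.contMDiff_smul (L.contDiff.contMDiff.comp_contMDiffOn contMDiffOn_extChartAt)
  have hd : HasMFDerivAt 𝓘(ℝ, E) 𝓘(ℝ, ℝ) (fun y => L (extChartAt 𝓘(ℝ, E) x y)) x
      (L.comp (mfderiv 𝓘(ℝ, E) 𝓘(ℝ, E) (extChartAt 𝓘(ℝ, E) x) x)) :=
    (L.hasMFDerivAt (x := extChartAt 𝓘(ℝ, E) x x)).comp x
      (mdifferentiableAt_extChartAt (mem_chart_source E x)).hasMFDerivAt
  have hev : (fun y => f y • L (extChartAt 𝓘(ℝ, E) x y)) =ᶠ[𝓝 x]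
      fun y => L (extChartAt 𝓘(ℝ, E) x y) := by
    filter_upwards [f.eventuallyEq_one] with y hy
    simp [hy]
  have h0 := h _ hu
  rw [dReal, hev.mfderiv_eq, hd.mfderiv, mfderiv_extChartAt_self] at h0
  exact h0

theorem dComplex_re (f : Smooth E M) (x : M) (v : TangentSpace 𝓘(ℝ, E) x) :
    (dComplex f x v).re = dReal (fun y => (f y).re) x v := by
  have h := (Complex.reCLM.hasMFDerivAt (x := f x)).comp x
    (f.contMDiff.mdifferentiable (by simp) x).hasMFDerivAt
  exact (congrArg (fun A : E →L[ℝ] ℝ => A v) h.mfderiv).symm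

theorem dComplex_im (f : Smooth E M) (x : M) (v : TangentSpace 𝓘(ℝ, E) x) :
    (dComplex f x v).im = dReal (fun y => (f y).im) x v := by
  have h := (Complex.imCLM.hasMFDerivAt (x := f x)).comp x
    (f.contMDiff.mdifferentiable (by simp) x).hasMFDerivAt
  exact (congrArg (fun A : E →L[ℝ] ℝ => A v) h.mfderiv).symm

theorem contMDiff_re (f : Smooth E M) : ContMDiff 𝓘(ℝ, E) 𝓘(ℝ, ℝ) ∞ fun y => (f y).re :=
  Complex.reCLM.contDiff.contMDiff.comp f.contMDiff

theorem contMDiff_im (f : Smooth E M) : ContMDiff 𝓘(ℝ, E) 𝓘(ℝ, ℝ) ∞ fun y => (f y).im :=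
  Complex.imCLM.contDiff.contMDiff.comp f.contMDiff

/-- A real smooth function, regarded as a complex one. -/
noncomputable def Smooth.ofReal (u : M → ℝ) (hu : ContMDiff 𝓘(ℝ, E) 𝓘(ℝ, ℝ) ∞ u) : Smooth E M :=
  ⟨fun y => (u y : ℂ), Complex.ofRealCLM.contDiff.contMDiff.comp hu⟩

theorem Smooth.dComplex_ofReal_re {u : M → ℝ} (hu : ContMDiff 𝓘(ℝ, E) 𝓘(ℝ, ℝ) ∞ u) (x : M)
    (v : TangentSpace 𝓘(ℝ, E) x) : (dComplex (Smooth.ofReal u hu) x v).re = dReal u x v :=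
  dComplex_re _ x v

theorem Smooth.dComplex_ofReal_im {u : M → ℝ} (hu : ContMDiff 𝓘(ℝ, E) 𝓘(ℝ, ℝ) ∞ u) (x : M)
    (v : TangentSpace 𝓘(ℝ, E) x) : (dComplex (Smooth.ofReal u hu) x v).im = 0 := by
  have h : (fun y => (Smooth.ofReal u hu y).im) = fun _ => (0 : ℝ) := rfl
  rw [dComplex_im, h, dReal, mfderiv_const]
  rfl

variable [FiniteDimensional ℝ E]

theorem SymplecticForm.dReal_eq_zero_of_hamVec_eq_zero (Ω : SymplecticForm E M) {u : M → ℝ} {x : M}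
    (h : Ω.hamVec u x = 0) : dReal (E := E) u x = 0 := by
  ext w
  have h1 := Ω.toForm_hamVec u x w
  rw [h, ← Ω.flat_apply, map_zero] at h1
  simpa using h1.symm

variable [IsManifold 𝓘(ℝ, E) ∞ M] [T2Space M]

/-- A real vector field that acts on functions as `{a, ·}` is the Hamiltonian vector field of
`Re a`. -/
theorem SymplecticForm.eq_hamVec_re (Ω : SymplecticForm E M) (a : Smooth E M) {x : M}
    {v : TangentSpace 𝓘(ℝ, E) x} (h : ∀ f : Smooth E M, dComplex f x v = Ω.poisson a f x) :
    v = Ω.hamVec (fun y => (a y).re) x := by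
  rw [← sub_eq_zero]
  refine tangent_eq_zero_of_dReal fun u hu => ?_
  have h1 := congrArg Complex.re (h (Smooth.ofReal u hu))
  rw [poisson, Complex.add_re, Complex.I_mul_re, Smooth.dComplex_ofReal_im,
    Smooth.dComplex_ofReal_re, Smooth.dComplex_ofReal_re] at h1
  rw [map_sub, sub_eq_zero]
  simpa using h1

/-- If a real vector field acts on functions as `{a, ·}`, then `Im a` has zero differential. -/
theorem SymplecticForm.dReal_im_eq_zero (Ω : SymplecticForm E M) (a : Smooth E M) {x : M}
    {v : TangentSpace 𝓘(ℝ, E) x} (h : ∀ f : Smooth E M, dComplex f x v = Ω.poisson a f x) :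
    dReal (E := E) (fun y => (a y).im) x = 0 := by
  refine Ω.dReal_eq_zero_of_hamVec_eq_zero (tangent_eq_zero_of_dReal fun u hu => ?_)
  have h1 := congrArg Complex.im (h (Smooth.ofReal u hu))
  rw [poisson, Complex.add_im, Complex.I_mul_im, Smooth.dComplex_ofReal_im,
    Smooth.dComplex_ofReal_im, zero_add, Smooth.dComplex_ofReal_re] at h1
  exact h1.symm

end Manifold

/-! ### The derivative of the adjoint action -/

section Chart

variable {F : Type*} [NormedAddCommGroup F] [NormedSpace ℝ F]

/-- The derivative of conjugation for a local multiplication `m` with unit `e`. The conjugation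
`K (a, b) = a b a⁻¹` is characterized by `m (K (a, b), a) = m (a, b)`; differentiating this in `b`
gives `R_a (Ad_a w) = L_a w`, and then differentiating in `a` expresses `(d Ad) w` by the left
invariant fields `V_w a = ∂₂ m (a, e) w`. -/
theorem hasFDerivAt_localConj {m K : F × F → F} {e : F} (hm : ContDiffAt ℝ 2 m (e, e))
    (hK : ContDiffAt ℝ 2 K (e, e)) (hme : ∀ᶠ a in 𝓝 e, m (a, e) = a)
    (hem : ∀ᶠ a in 𝓝 e, m (e, a) = a) (hKe : ∀ᶠ a in 𝓝 e, K (a, e) = e)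
    (hmK : ∀ᶠ p in 𝓝 (e, e), m (K p, p.1) = m p) (w : F) :
    fderiv ℝ m (e, e) (0, w) = w ∧
    DifferentiableAt ℝ (fun a => fderiv ℝ K (a, e) (0, w)) e ∧
    ∀ v, fderiv ℝ (fun a => fderiv ℝ K (a, e) (0, w)) e v =
      fderiv ℝ (fun a => fderiv ℝ m (a, e) (0, w)) e v -
        fderiv ℝ (fun a => fderiv ℝ m (a, e) (0, v)) e w := by
  have hce : Filter.Tendsto (fun a : F => (a, e)) (𝓝 e) (𝓝 (e, e)) :=
    (Continuous.prodMk_left e).tendsto e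
  have hec : Filter.Tendsto (fun a : F => (e, a)) (𝓝 e) (𝓝 (e, e)) :=
    (Continuous.prodMk_right e).tendsto e
  have hmd : ∀ᶠ p in 𝓝 (e, e), DifferentiableAt ℝ m p :=
    (hm.eventually (by simp)).mono fun p hp => hp.differentiableAt (by simp)
  have hKd : ∀ᶠ p in 𝓝 (e, e), DifferentiableAt ℝ K p :=
    (hK.eventually (by simp)).mono fun p hp => hp.differentiableAt (by simp)
  -- The two partial derivatives of `m` at `(e, e)` are the identity.
  have hm1 (v : F) : fderiv ℝ m (e, e) (v, 0) = v := by
    have h1 := HasFDerivAt.comp (f := fun a : F => (a, e)) e hmd.self_of_nhds.hasFDerivAt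
      (hasFDerivAt_prodMk_left (𝕜 := ℝ) e e)
    have h2 := h1.congr_of_eventuallyEq (f₁ := id) (hme.mono fun a ha => ha.symm)
    simpa using congrArg (fun A : F →L[ℝ] F => A v) (h2.unique (hasFDerivAt_id e))
  have hm2 (v : F) : fderiv ℝ m (e, e) (0, v) = v := by
    have h1 := hmd.self_of_nhds.hasFDerivAt.comp e (hasFDerivAt_prodMk_right (𝕜 := ℝ) e e)
    have h2 := h1.congr_of_eventuallyEq (f₁ := id) (hem.mono fun a ha => ha.symm)
    simpa using congrArg (fun A : F →L[ℝ] F => A v) (h2.unique (hasFDerivAt_id e))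
  -- `R_a (Ad_a w) = L_a w`
  have hRL (w : F) : ∀ᶠ a in 𝓝 e, fderiv ℝ m (e, a) (fderiv ℝ K (a, e) (0, w), 0) =
      fderiv ℝ m (a, e) (0, w) := by
    rw [nhds_prod_eq] at hmK
    filter_upwards [hmK.curry, hKe, hec.eventually hmd, hce.eventually hmd, hce.eventually hKd]
      with a ha hae hd1 hd2 hd3
    have h1 := hd2.hasFDerivAt.comp e (hasFDerivAt_prodMk_right (𝕜 := ℝ) a e)
    have h2 := (hd3.hasFDerivAt.comp e (hasFDerivAt_prodMk_right (𝕜 := ℝ) a e)).prodMk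
      (hasFDerivAt_const (𝕜 := ℝ) a e)
    rw [← hae] at hd1
    have h3 := HasFDerivAt.comp e hd1.hasFDerivAt h2
    have h4 := h3.congr_of_eventuallyEq (f₁ := m ∘ fun b => (a, b)) (ha.mono fun b hb => hb.symm)
    have h5 := congrArg (fun A : F →L[ℝ] F => A w) (h4.unique h1)
    rw [hae] at h5
    simpa using h5
  have hKw : fderiv ℝ K (e, e) (0, w) = w := by
    have h := (hRL w).self_of_nhds
    rwa [hm1, hm2] at h
  have hm' : DifferentiableAt ℝ (fderiv ℝ m) (e, e) :=
    (hm.fderiv_right (m := 1) (by norm_num)).differentiableAt (by simp)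
  have hK' : DifferentiableAt ℝ (fderiv ℝ K) (e, e) :=
    (hK.fderiv_right (m := 1) (by norm_num)).differentiableAt (by simp)
  have hV (w : F) := (HasFDerivAt.comp (f := fun a : F => (a, e)) e hm'.hasFDerivAt
    (hasFDerivAt_prodMk_left (𝕜 := ℝ) e e)).clm_apply
    (hasFDerivAt_const (𝕜 := ℝ) ((0 : F), w) e)
  have hA := (HasFDerivAt.comp (f := fun a : F => (a, e)) e hK'.hasFDerivAt
    (hasFDerivAt_prodMk_left (𝕜 := ℝ) e e)).clm_apply
    (hasFDerivAt_const (𝕜 := ℝ) ((0 : F), w) e)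
  refine ⟨hm2 w, hA.differentiableAt, fun v => ?_⟩
  -- Differentiating `R_a (Ad_a w) = L_a w` in `a` and using the symmetry of the second derivative
  -- of `m` turns the term `D²m (0, v) (w, 0)` into the derivative of `V_v` along `w`.
  have hR := (hm'.hasFDerivAt.comp e (hasFDerivAt_prodMk_right (𝕜 := ℝ) e e)).clm_apply
    (hA.differentiableAt.hasFDerivAt.prodMk (hasFDerivAt_const (𝕜 := ℝ) (0 : F) e))
  have h1 := hR.unique ((hV w).differentiableAt.hasFDerivAt.congr_of_eventuallyEq (hRL w))
  have h2 := congrArg (fun A : F →L[ℝ] F => A v) h1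
  have h3 := congrArg (fun A : F →L[ℝ] F => A w) (hV v).fderiv
  have hsymm := (hm.isSymmSndFDerivAt (by simp)) (0, v) (w, 0)
  simp only [Function.comp_def, add_apply, ContinuousLinearMap.comp_apply,
    ContinuousLinearMap.flip_apply, ContinuousLinearMap.inr_apply, ContinuousLinearMap.inl_apply,
    ContinuousLinearMap.prod_apply, zero_apply, map_zero, zero_add, hm1,
    hKw] at h2 h3
  rw [h3, ← hsymm, ← h2]
  abel

end Chart

section LieGroup

variable {F : Type*} [NormedAddCommGroup F] [NormedSpace ℝ F]
  {G : Type*} [TopologicalSpace G] [ChartedSpace F G] [Group G]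

/-- The multiplication of a Lie group in the chart at the identity. -/
noncomputable def chartMul (F G : Type*) [NormedAddCommGroup F] [NormedSpace ℝ F]
    [TopologicalSpace G] [ChartedSpace F G] [Group G] (p : F × F) : F :=
  extChartAt 𝓘(ℝ, F) (1 : G)
    ((extChartAt 𝓘(ℝ, F) (1 : G)).symm p.1 * (extChartAt 𝓘(ℝ, F) (1 : G)).symm p.2)

/-- Conjugation `(g, h) ↦ g h g⁻¹` in the chart at the identity. -/
noncomputable def chartConj (F G : Type*) [NormedAddCommGroup F] [NormedSpace ℝ F]
    [TopologicalSpace G] [ChartedSpace F G] [Group G] (p : F × F) : F :=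
  extChartAt 𝓘(ℝ, F) (1 : G)
    ((extChartAt 𝓘(ℝ, F) (1 : G)).symm p.1 * (extChartAt 𝓘(ℝ, F) (1 : G)).symm p.2 *
      ((extChartAt 𝓘(ℝ, F) (1 : G)).symm p.1)⁻¹)

/-- The tangent space at the identity is the model space, identified through the preferred chart;
so derivatives at the identity are derivatives in that chart. -/
theorem mfderiv_one_eq_fderiv {W : Type*} [NormedAddCommGroup W] [NormedSpace ℝ W] {f : G → W}
    (hf : MDifferentiableAt 𝓘(ℝ, F) 𝓘(ℝ, W) f 1) :
    (mfderiv 𝓘(ℝ, F) 𝓘(ℝ, W) f 1 : F →L[ℝ] W) =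
      fderiv ℝ (f ∘ (extChartAt 𝓘(ℝ, F) (1 : G)).symm) (extChartAt 𝓘(ℝ, F) (1 : G) 1) := by
  rw [hf.mfderiv]
  simp only [modelWithCornersSelf_coe, Set.range_id, fderivWithin_univ]
  rfl

theorem mfderiv_one_eq_fderiv_chart {f : G → G} (hf : MDifferentiableAt 𝓘(ℝ, F) 𝓘(ℝ, F) f 1)
    (h1 : f 1 = 1) :
    (mfderiv 𝓘(ℝ, F) 𝓘(ℝ, F) f 1 : F →L[ℝ] F) =
      fderiv ℝ (extChartAt 𝓘(ℝ, F) (1 : G) ∘ f ∘ (extChartAt 𝓘(ℝ, F) (1 : G)).symm)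
        (extChartAt 𝓘(ℝ, F) (1 : G) 1) := by
  rw [hf.mfderiv]
  simp only [modelWithCornersSelf_coe, Set.range_id, fderivWithin_univ, writtenInExtChartAt, h1]
  rfl

theorem Ad_one (w : GroupLieAlgebra 𝓘(ℝ, F) G) : Ad (F := F) (1 : G) w = w := by
  have h : (fun h : G => (1 : G) * h * (1 : G)⁻¹) = id := by ext; simp
  rw [Ad, h, mfderiv_id]
  rfl

variable [LieGroup 𝓘(ℝ, F) ∞ G]

theorem contMDiffAt_chart_symm :
    ContMDiffAt 𝓘(ℝ, F) 𝓘(ℝ, F) ∞ (extChartAt 𝓘(ℝ, F) (1 : G)).symm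
      (extChartAt 𝓘(ℝ, F) (1 : G) 1) := by
  have : IsManifold 𝓘(ℝ, F) ∞ G := ContMDiffMul.toIsManifold
  exact (contMDiffOn_extChartAt_symm (1 : G)).contMDiffAt (extChartAt_target_mem_nhds 1)

theorem contDiffAt_chartMul : ContDiffAt ℝ ∞ (chartMul F G)
    (extChartAt 𝓘(ℝ, F) (1 : G) 1, extChartAt 𝓘(ℝ, F) (1 : G) 1) := by
  have : IsManifold 𝓘(ℝ, F) ∞ G := ContMDiffMul.toIsManifold
  have hf := ContMDiffAt.comp (I := 𝓘(ℝ, F × F))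
    (extChartAt 𝓘(ℝ, F) (1 : G) 1, extChartAt 𝓘(ℝ, F) (1 : G) 1)
    contMDiffAt_chart_symm contDiff_fst.contMDiff.contMDiffAt
  have hs := ContMDiffAt.comp (I := 𝓘(ℝ, F × F))
    (extChartAt 𝓘(ℝ, F) (1 : G) 1, extChartAt 𝓘(ℝ, F) (1 : G) 1)
    contMDiffAt_chart_symm contDiff_snd.contMDiff.contMDiffAt
  refine ContMDiffAt.contDiffAt ?_
  refine ContMDiffAt.comp_of_eq (y := (1 : G)) contMDiffAt_extChartAt (hf.mul hs) ?_
  simp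

theorem contDiffAt_chartConj : ContDiffAt ℝ ∞ (chartConj F G)
    (extChartAt 𝓘(ℝ, F) (1 : G) 1, extChartAt 𝓘(ℝ, F) (1 : G) 1) := by
  have : IsManifold 𝓘(ℝ, F) ∞ G := ContMDiffMul.toIsManifold
  have hf := ContMDiffAt.comp (I := 𝓘(ℝ, F × F))
    (extChartAt 𝓘(ℝ, F) (1 : G) 1, extChartAt 𝓘(ℝ, F) (1 : G) 1)
    contMDiffAt_chart_symm contDiff_fst.contMDiff.contMDiffAt
  have hs := ContMDiffAt.comp (I := 𝓘(ℝ, F × F))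
    (extChartAt 𝓘(ℝ, F) (1 : G) 1, extChartAt 𝓘(ℝ, F) (1 : G) 1)
    contMDiffAt_chart_symm contDiff_snd.contMDiff.contMDiffAt
  refine ContMDiffAt.contDiffAt ?_
  refine ContMDiffAt.comp_of_eq (y := (1 : G)) contMDiffAt_extChartAt ((hf.mul hs).mul hf.inv) ?_
  simp

theorem mdifferentiable_conj (g : G) :
    MDifferentiable 𝓘(ℝ, F) 𝓘(ℝ, F) fun h : G => g * h * g⁻¹ :=
  ((contMDiff_mul_right (I := 𝓘(ℝ, F)) (n := ∞)).comp
    (contMDiff_mul_left (I := 𝓘(ℝ, F)) (n := ∞))).mdifferentiable (by simp)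

theorem eventually_Ad_eq : ∀ᶠ a in 𝓝 (extChartAt 𝓘(ℝ, F) (1 : G) 1),
    ∀ w : F, Ad (F := F) ((extChartAt 𝓘(ℝ, F) (1 : G)).symm a) w =
      fderiv ℝ (chartConj F G) (a, extChartAt 𝓘(ℝ, F) (1 : G) 1) (0, w) := by
  have hd : ∀ᶠ a in 𝓝 (extChartAt 𝓘(ℝ, F) (1 : G) 1),
      DifferentiableAt ℝ (chartConj F G) (a, extChartAt 𝓘(ℝ, F) (1 : G) 1) :=
    ((Continuous.prodMk_left _).tendsto _).eventually
      (((contDiffAt_chartConj.of_le (m := 2) (by norm_cast)).eventually (by simp)).mono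
        fun p hp => hp.differentiableAt (by simp))
  filter_upwards [hd] with a ha w
  have h1 := mfderiv_one_eq_fderiv_chart
    (mdifferentiable_conj (F := F) ((extChartAt 𝓘(ℝ, F) (1 : G)).symm a) 1) (by simp)
  have h2 := ha.hasFDerivAt.comp _ (hasFDerivAt_prodMk_right (𝕜 := ℝ) a _)
  have h3 := congrArg (fun A : F →L[ℝ] F => A w) (h1.trans h2.fderiv)
  exact h3

/-- The left invariant field of `w` is `a ↦ ∂₂ m (a, e) w` in the chart at the identity. -/
theorem eventually_mpullback_eq : ∀ᶠ a in 𝓝 (extChartAt 𝓘(ℝ, F) (1 : G) 1),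
    ∀ w : GroupLieAlgebra 𝓘(ℝ, F) G,
      VectorField.mpullbackWithin 𝓘(ℝ, F) 𝓘(ℝ, F) (extChartAt 𝓘(ℝ, F) (1 : G)).symm
        (mulInvariantVectorField w) (Set.range 𝓘(ℝ, F)) a =
      fderiv ℝ (chartMul F G) (a, extChartAt 𝓘(ℝ, F) (1 : G) 1) (0, w) := by
  have : IsManifold 𝓘(ℝ, F) ∞ G := ContMDiffMul.toIsManifold
  have : IsManifold 𝓘(ℝ, F) 1 G := IsManifold.of_le (n := ∞) (by norm_cast)
  have hd : ∀ᶠ a in 𝓝 (extChartAt 𝓘(ℝ, F) (1 : G) 1),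
      DifferentiableAt ℝ (chartMul F G) (a, extChartAt 𝓘(ℝ, F) (1 : G) 1) :=
    ((Continuous.prodMk_left _).tendsto _).eventually
      (((contDiffAt_chartMul.of_le (m := 2) (by norm_cast)).eventually (by simp)).mono
        fun p hp => hp.differentiableAt (by simp))
  filter_upwards [hd, extChartAt_target_mem_nhds (I := 𝓘(ℝ, F)) (1 : G)] with a ha hat w
  set ψ := (extChartAt 𝓘(ℝ, F) (1 : G)).symm with hψ
  have hinv : (mfderivWithin 𝓘(ℝ, F) 𝓘(ℝ, F) ψ (Set.range 𝓘(ℝ, F)) a).inverse =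
      mfderiv 𝓘(ℝ, F) 𝓘(ℝ, F) (extChartAt 𝓘(ℝ, F) (1 : G)) (ψ a) :=
    ContinuousLinearMap.inverse_eq
      (mfderivWithin_extChartAt_symm_comp_mfderiv_extChartAt hat)
      (mfderiv_extChartAt_comp_mfderivWithin_extChartAt_symm hat)
  have hs : ψ a ∈ (chartAt F (1 : G)).source := by
    rw [← extChartAt_source 𝓘(ℝ, F)]
    exact (extChartAt 𝓘(ℝ, F) (1 : G)).map_target hat
  have hφ := (mdifferentiableAt_extChartAt (I := 𝓘(ℝ, F)) hs)
  have hL : MDifferentiableAt 𝓘(ℝ, F) 𝓘(ℝ, F) (fun g : G => ψ a * g) 1 :=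
    (contMDiff_mul_left (I := 𝓘(ℝ, F)) (n := ∞)).mdifferentiable (by simp) 1
  have hc := mfderiv_comp_of_eq (x := (1 : G)) (y := ψ a) hφ hL (mul_one _)
  have h1 := mfderiv_one_eq_fderiv
    (MDifferentiableAt.comp_of_eq (x := (1 : G)) (y := ψ a) hφ hL (mul_one _))
  have h2 := ha.hasFDerivAt.comp _ (hasFDerivAt_prodMk_right (𝕜 := ℝ) a _)
  have h3 := congrArg (fun A : F →L[ℝ] F => A w) (h1.trans h2.fderiv)
  rw [hc] at h3
  -- The base points `ψ a * 1` and `ψ a` are only propositionally equal, so the derivatives are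
  -- compared as maps of the model space.
  have h4 : (mfderiv 𝓘(ℝ, F) 𝓘(ℝ, F) (extChartAt 𝓘(ℝ, F) (1 : G)) (ψ a * 1) : F →L[ℝ] F) =
      (mfderiv 𝓘(ℝ, F) 𝓘(ℝ, F) (extChartAt 𝓘(ℝ, F) (1 : G)) (ψ a) : F →L[ℝ] F) := by
    rw [mul_one]
  rw [VectorField.mpullbackWithin_apply, hinv]
  exact (congrArg (fun A : F →L[ℝ] F => A (mfderiv 𝓘(ℝ, F) 𝓘(ℝ, F) (fun g : G => ψ a * g) 1 w))
    h4).symm.trans h3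

theorem bracket_eq (v w : GroupLieAlgebra 𝓘(ℝ, F) G) :
    ⁅v, w⁆ = VectorField.lieBracket ℝ
      (fun a => fderiv ℝ (chartMul F G) (a, extChartAt 𝓘(ℝ, F) (1 : G) 1) (0, (v : F)))
      (fun a => fderiv ℝ (chartMul F G) (a, extChartAt 𝓘(ℝ, F) (1 : G) 1) (0, (w : F)))
      (extChartAt 𝓘(ℝ, F) (1 : G) 1) := by
  have : IsManifold 𝓘(ℝ, F) ∞ G := ContMDiffMul.toIsManifold
  have : IsManifold 𝓘(ℝ, F) 1 G := IsManifold.of_le (n := ∞) (by norm_cast)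
  have hid : (mfderiv 𝓘(ℝ, F) 𝓘(ℝ, F) (extChartAt 𝓘(ℝ, F) (1 : G)) 1).inverse =
      ContinuousLinearMap.id ℝ F :=
    (congrArg (fun A : F →L[ℝ] F => A.inverse) mfderiv_extChartAt_self).trans
      ContinuousLinearMap.inverse_id
  rw [GroupLieAlgebra.bracket_def, ← VectorField.mlieBracketWithin_univ,
    VectorField.mlieBracketWithin_apply, hid, Set.preimage_univ, Set.univ_inter]
  have hcongr (X Y X' Y' : F → F) (hX : X =ᶠ[𝓝 (extChartAt 𝓘(ℝ, F) (1 : G) 1)] X')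
      (hY : Y =ᶠ[𝓝 (extChartAt 𝓘(ℝ, F) (1 : G) 1)] Y') :
      VectorField.lieBracketWithin ℝ X Y (Set.range 𝓘(ℝ, F)) (extChartAt 𝓘(ℝ, F) (1 : G) 1) =
        VectorField.lieBracket ℝ X' Y' (extChartAt 𝓘(ℝ, F) (1 : G) 1) := by
    rw [modelWithCornersSelf_coe, Set.range_id, VectorField.lieBracketWithin_univ]
    exact hX.lieBracket_vectorField_eq hY
  exact hcongr _ _ _ _ (eventually_mpullback_eq.mono fun a ha => ha v)
    (eventually_mpullback_eq.mono fun a ha => ha w)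

/-- The differential of `Ad` at the identity is `ad`, read in the chart at the identity. -/
theorem hasFDerivAt_Ad (w : GroupLieAlgebra 𝓘(ℝ, F) G) :
    ∃ A : F →L[ℝ] F, HasFDerivAt
      (fun a => (Ad (F := F) ((extChartAt 𝓘(ℝ, F) (1 : G)).symm a) w : F)) A
      (extChartAt 𝓘(ℝ, F) (1 : G) 1) ∧
      ∀ v : GroupLieAlgebra 𝓘(ℝ, F) G, A v = ⁅v, w⁆ := by
  have hψ : ContinuousAt (extChartAt 𝓘(ℝ, F) (1 : G)).symm (extChartAt 𝓘(ℝ, F) (1 : G) 1) :=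
    continuousAt_extChartAt_symm 1
  have hφψ := (extChartAt_target_mem_nhds (I := 𝓘(ℝ, F)) (1 : G))
  have hme : ∀ᶠ a in 𝓝 (extChartAt 𝓘(ℝ, F) (1 : G) 1),
      chartMul F G (a, extChartAt 𝓘(ℝ, F) (1 : G) 1) = a := by
    filter_upwards [hφψ] with a ha
    simp only [chartMul, extChartAt_to_inv, mul_one]
    exact (extChartAt 𝓘(ℝ, F) (1 : G)).right_inv ha
  have hem : ∀ᶠ a in 𝓝 (extChartAt 𝓘(ℝ, F) (1 : G) 1),
      chartMul F G (extChartAt 𝓘(ℝ, F) (1 : G) 1, a) = a := by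
    filter_upwards [hφψ] with a ha
    simp only [chartMul, extChartAt_to_inv, one_mul]
    exact (extChartAt 𝓘(ℝ, F) (1 : G)).right_inv ha
  have hKe : ∀ᶠ a in 𝓝 (extChartAt 𝓘(ℝ, F) (1 : G) 1),
      chartConj F G (a, extChartAt 𝓘(ℝ, F) (1 : G) 1) = extChartAt 𝓘(ℝ, F) (1 : G) 1 :=
    .of_forall fun a => by simp only [chartConj, extChartAt_to_inv, mul_one, mul_inv_cancel]
  have hmK : ∀ᶠ p in 𝓝 (extChartAt 𝓘(ℝ, F) (1 : G) 1, extChartAt 𝓘(ℝ, F) (1 : G) 1),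
      chartMul F G (chartConj F G p, p.1) = chartMul F G p := by
    have : IsTopologicalGroup G := topologicalGroup_of_lieGroup 𝓘(ℝ, F) ∞
    have hc1 : ContinuousAt (fun p : F × F => (extChartAt 𝓘(ℝ, F) (1 : G)).symm p.1)
        (extChartAt 𝓘(ℝ, F) (1 : G) 1, extChartAt 𝓘(ℝ, F) (1 : G) 1) :=
      ContinuousAt.comp (f := Prod.fst) hψ continuousAt_fst
    have hc2 : ContinuousAt (fun p : F × F => (extChartAt 𝓘(ℝ, F) (1 : G)).symm p.2)
        (extChartAt 𝓘(ℝ, F) (1 : G) 1, extChartAt 𝓘(ℝ, F) (1 : G) 1) :=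
      ContinuousAt.comp (f := Prod.snd) hψ continuousAt_snd
    have hc := ((hc1.mul hc2).mul hc1.inv).preimage_mem_nhds
      (t := (extChartAt 𝓘(ℝ, F) (1 : G)).source)
      (by simpa using chart_source_mem_nhds F (1 : G))
    filter_upwards [hc] with p hp
    have hl : (extChartAt 𝓘(ℝ, F) (1 : G)).symm (chartConj F G p) = _ :=
      (extChartAt 𝓘(ℝ, F) (1 : G)).left_inv hp
    rw [chartMul, hl]
    exact congrArg (extChartAt 𝓘(ℝ, F) (1 : G)) (inv_mul_cancel_right _ _)
  have hloc := hasFDerivAt_localConj (contDiffAt_chartMul.of_le (by norm_cast))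
    (contDiffAt_chartConj.of_le (by norm_cast)) hme hem hKe hmK
  refine ⟨_, (hloc w).2.1.hasFDerivAt.congr_of_eventuallyEq
    (eventually_Ad_eq.mono fun a ha => ha w), fun v => ?_⟩
  rw [bracket_eq, VectorField.lieBracket]
  refine ((hloc w).2.2 v).trans ?_
  rw [(hloc v).1, (hloc w).1]

theorem Ad_mul (g h : G) (w : GroupLieAlgebra 𝓘(ℝ, F) G) :
    Ad (g * h) w = Ad g (Ad (F := F) h w) := by
  have hc : (fun k : G => g * h * k * (g * h)⁻¹) =
      (fun k => g * k * g⁻¹) ∘ fun k => h * k * h⁻¹ := by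
    ext k
    simp [mul_assoc]
  have h1 := mfderiv_comp_of_eq (x := (1 : G)) (y := (1 : G))
    (mdifferentiable_conj (F := F) g 1) (mdifferentiable_conj h 1) (by simp)
  rw [← hc] at h1
  have h2 : (mfderiv 𝓘(ℝ, F) 𝓘(ℝ, F) (fun k : G => g * k * g⁻¹) (h * 1 * h⁻¹) : F →L[ℝ] F) =
      (mfderiv 𝓘(ℝ, F) 𝓘(ℝ, F) (fun k : G => g * k * g⁻¹) 1 : F →L[ℝ] F) := by
    rw [mul_one, mul_inv_cancel]
  exact (congrArg (fun A : F →L[ℝ] F => A w) h1).trans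
    (congrArg (fun A : F →L[ℝ] F => A (Ad (F := F) h w)) h2)

end LieGroup

/-! ### Equivariance of momentum maps -/

section Equivariance

variable {E : Type*} [NormedAddCommGroup E] [NormedSpace ℝ E] [FiniteDimensional ℝ E]
  {M : Type*} [TopologicalSpace M] [ChartedSpace E M]
  {F : Type*} [NormedAddCommGroup F] [NormedSpace ℝ F]
  {G : Type*} [TopologicalSpace G] [ChartedSpace F G] [Group G] [LieGroup 𝓘(ℝ, F) ∞ G]
  [MulAction G M] [ContMDiffSMul 𝓘(ℝ, F) 𝓘(ℝ, E) ∞ G M]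
  {Ω : SymplecticForm E M} {J : M → (GroupLieAlgebra 𝓘(ℝ, F) G →L[ℝ] ℝ)}

/-- The derivative of `J_ζ` along the orbit map is `v ↦ -{J_v, J_ζ}`. -/
theorem IsMomentumMap.hasFDerivAt_orbit (hJ : IsMomentumMap Ω J)
    (ζ : GroupLieAlgebra 𝓘(ℝ, F) G) (y : M) :
    ∃ B : F →L[ℝ] ℝ, HasFDerivAt
      (fun a => J ((extChartAt 𝓘(ℝ, F) (1 : G)).symm a • y) ζ) B (extChartAt 𝓘(ℝ, F) (1 : G) 1) ∧
      ∀ v : GroupLieAlgebra 𝓘(ℝ, F) G,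
        B v = -Ω.poissonReal (fun z => J z v) (fun z => J z ζ) y := by
  have horb : MDifferentiableAt 𝓘(ℝ, F) 𝓘(ℝ, E) (fun g : G => g • y) 1 :=
    ((contMDiff_smul (I := 𝓘(ℝ, F)) (I' := 𝓘(ℝ, E)) (n := ∞) (G := G) (M := M)).comp
      (contMDiff_id.prodMk contMDiff_const)).mdifferentiable (by simp) 1
  have hζ : MDifferentiableAt 𝓘(ℝ, E) 𝓘(ℝ, ℝ) (fun z => J z ζ) ((1 : G) • y) :=
    (hJ.smooth ζ).mdifferentiable (by simp) _
  have hc : MDifferentiableAt 𝓘(ℝ, F) 𝓘(ℝ, ℝ) (fun g : G => J (g • y) ζ) 1 := hζ.comp 1 horb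
  have hmf : HasMFDerivAt 𝓘(ℝ, F) 𝓘(ℝ, ℝ) (fun g : G => J (g • y) ζ) 1 _ :=
    hζ.hasMFDerivAt.comp 1 horb.hasMFDerivAt
  have : IsManifold 𝓘(ℝ, F) ∞ G := ContMDiffMul.toIsManifold
  have hψ := (contMDiffAt_chart_symm (F := F) (G := G)).mdifferentiableAt (by simp)
  have hd : MDifferentiableAt 𝓘(ℝ, F) 𝓘(ℝ, ℝ)
      ((fun g : G => J (g • y) ζ) ∘ (extChartAt 𝓘(ℝ, F) (1 : G)).symm)
      (extChartAt 𝓘(ℝ, F) (1 : G) 1) := by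
    refine MDifferentiableAt.comp_of_eq (y := (1 : G)) _ hc hψ ?_
    exact extChartAt_to_inv 1
  refine ⟨_, hd.differentiableAt.hasFDerivAt, fun v => ?_⟩
  rw [← mfderiv_one_eq_fderiv hc, hmf.mfderiv]
  have h1 : (mfderiv 𝓘(ℝ, E) 𝓘(ℝ, ℝ) (fun z => J z ζ) ((1 : G) • y) : E →L[ℝ] ℝ) =
      (mfderiv 𝓘(ℝ, E) 𝓘(ℝ, ℝ) (fun z => J z ζ) y : E →L[ℝ] ℝ) := by
    rw [one_smul]
  have h2 : Ω.poissonReal (fun z => J z v) (fun z => J z ζ) y =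
      (mfderiv 𝓘(ℝ, E) 𝓘(ℝ, ℝ) (fun z => J z ζ) y : E →L[ℝ] ℝ)
        (-(mfderiv 𝓘(ℝ, F) 𝓘(ℝ, E) (fun g : G => g • y) 1 v : E)) := by
    rw [SymplecticForm.poissonReal, ← hJ.hamiltonian v y]
    rfl
  have h3 (T : E →L[ℝ] ℝ) (e : E) : T e = -T (-e) := by simp
  rw [h2, ← h1]
  exact h3 _ _

variable [FiniteDimensional ℝ F]

/-- The derivative at the identity of `g ↦ ⟨J(g y), Ad_g η⟩` along `v` is
`-{J_v, J_η} + J_{[v, η]}` at `y`. -/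
theorem IsMomentumMap.hasMFDerivAt_one (hJ : IsMomentumMap Ω J)
    (hinf : ∀ (ξ η : GroupLieAlgebra 𝓘(ℝ, F) G) (x : M),
      Ω.poissonReal (fun y => J y ξ) (fun y => J y η) x = J x ⁅ξ, η⁆)
    (y : M) (η : GroupLieAlgebra 𝓘(ℝ, F) G) :
    HasMFDerivAt 𝓘(ℝ, F) 𝓘(ℝ, ℝ) (fun g : G => J (g • y) (Ad g η)) 1 (0 : F →L[ℝ] ℝ) := by
  have : IsManifold 𝓘(ℝ, F) ∞ G := ContMDiffMul.toIsManifold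
  have : IsManifold 𝓘(ℝ, F) 1 G := IsManifold.of_le (n := ∞) (by norm_cast)
  set ψ := (extChartAt 𝓘(ℝ, F) (1 : G)).symm with hψ
  let b : Module.Basis _ ℝ (GroupLieAlgebra 𝓘(ℝ, F) G) :=
    Module.finBasis ℝ (GroupLieAlgebra 𝓘(ℝ, F) G)
  have hJb (x : M) (w : GroupLieAlgebra 𝓘(ℝ, F) G) : J x w = ∑ i, b.repr w i * J x (b i) := by
    conv_lhs => rw [← b.sum_repr w, map_sum]
    simp only [map_smul, smul_eq_mul]
  obtain ⟨A, hA, hAv⟩ := hasFDerivAt_Ad η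
  -- Expanding in a basis reduces the pairing to products of scalar functions.
  choose B hB hBv using fun i => hJ.hasFDerivAt_orbit (b i) y
  let coord (i) : F →L[ℝ] ℝ := LinearMap.toContinuousLinearMap (E := F) (b.coord i)
  have hsum := HasFDerivAt.fun_sum (u := Finset.univ) fun i _ =>
    (((coord i).hasFDerivAt.comp _ hA).mul (hB i))
  have h0 : HasFDerivAt (fun a => J (ψ a • y) (Ad (ψ a) η)) (0 : F →L[ℝ] ℝ)
      (extChartAt 𝓘(ℝ, F) (1 : G) 1) := by
    refine (hsum.congr_fderiv ?_).congr_of_eventuallyEq (.of_forall fun a => hJb _ _)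
    have hzero (v : GroupLieAlgebra 𝓘(ℝ, F) G) :
        ∑ i, (b.repr (Ad (ψ (extChartAt 𝓘(ℝ, F) (1 : G) 1)) η) i * B i v +
          J y (b i) * b.repr (A v) i) = 0 := by
      have hv : J y ⁅v, η⁆ = ∑ i, b.repr η i * J y ⁅v, b i⁆ := by
        conv_lhs => rw [← b.sum_repr η, lie_sum, map_sum]
        simp only [lie_smul, map_smul, smul_eq_mul]
      rw [hψ, extChartAt_to_inv, Ad_one, Finset.sum_add_distrib]
      simp only [hBv, hinf, hAv, mul_neg, Finset.sum_neg_distrib]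
      rw [← hv, hJb y ⁅v, η⁆, neg_add_eq_zero]
      exact Finset.sum_congr rfl fun i _ => mul_comm _ _
    ext v
    simp only [sum_apply, add_apply, smul_apply, smul_eq_mul, extChartAt_to_inv, one_smul]
    exact hzero v
  have hφ := (mdifferentiableAt_extChartAt (I := 𝓘(ℝ, F)) (mem_chart_source F (1 : G)))
  have h1 := h0.hasMFDerivAt.comp (1 : G) hφ.hasMFDerivAt
  refine (h1.congr_of_eventuallyEq ?_).congr_mfderiv (ContinuousLinearMap.zero_comp _)
  filter_upwards [extChartAt_source_mem_nhds (I := 𝓘(ℝ, F)) (1 : G)] with g hg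
  simp only [Function.comp_apply, hψ, (extChartAt 𝓘(ℝ, F) (1 : G)).left_inv hg]

/-- A momentum map that intertwines the brackets is equivariant under the identity component:
`g ↦ ⟨J(g x), Ad_g ξ⟩` has zero differential, since right translation reduces its derivative at
any point to the one at the identity. -/
theorem IsMomentumMap.isEquivariantMap (hJ : IsMomentumMap Ω J)
    (hinf : ∀ (ξ η : GroupLieAlgebra 𝓘(ℝ, F) G) (x : M),
      Ω.poissonReal (fun y => J y ξ) (fun y => J y η) x = J x ⁅ξ, η⁆) :
    IsEquivariantMap Ω J := by
  refine ⟨hinf, fun g hg x ξ => ?_⟩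
  have : IsManifold 𝓘(ℝ, F) ∞ G := ContMDiffMul.toIsManifold
  have : IsManifold 𝓘(ℝ, F) 1 G := IsManifold.of_le (n := ∞) (by norm_cast)
  have hconst : IsLocallyConstant fun h : G => J (h • x) (Ad h (Ad g⁻¹ ξ)) := by
    refine isLocallyConstant_of_hasMFDerivAt_zero (E := F) fun g₀ => ?_
    have h1 : HasMFDerivAt 𝓘(ℝ, F) 𝓘(ℝ, ℝ)
        (fun h : G => J (h • g₀ • x) (Ad h (Ad g₀ (Ad g⁻¹ ξ)))) (g₀ * g₀⁻¹) (0 : F →L[ℝ] ℝ) := by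
      rw [mul_inv_cancel]
      exact hJ.hasMFDerivAt_one hinf _ _
    have h2 : HasMFDerivAt 𝓘(ℝ, F) 𝓘(ℝ, F) (fun h : G => h * g₀⁻¹) g₀ _ :=
      ((contMDiff_mul_right (I := 𝓘(ℝ, F)) (n := ∞)).mdifferentiable (by simp) g₀).hasMFDerivAt
    refine ((h1.comp g₀ h2).congr_of_eventuallyEq (.of_forall fun h => ?_)).congr_mfderiv
      (ContinuousLinearMap.zero_comp _)
    simp only [Function.comp_apply]
    rw [← mul_smul, ← Ad_mul (h * g₀⁻¹) g₀, inv_mul_cancel_right]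
  have h := hconst.apply_eq_of_isPreconnected isPreconnected_connectedComponent hg
    mem_connectedComponent
  simpa only [← Ad_mul, mul_inv_cancel, one_mul, one_smul, Ad_one] using h

end Equivariance

/-! ### The classical limit of a quantum momentum map -/

section ClassicalLimit

variable {E : Type*} [NormedAddCommGroup E] [NormedSpace ℝ E]
  {M : Type*} [TopologicalSpace M] [ChartedSpace E M]
  {F : Type*} [NormedAddCommGroup F] [NormedSpace ℝ F]
  {G : Type*} [TopologicalSpace G] [ChartedSpace F G] [Group G]

instance : T2Space (GroupLieAlgebra 𝓘(ℝ, F) G) := inferInstanceAs (T2Space F)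

variable [FiniteDimensional ℝ F] [LieGroup 𝓘(ℝ, F) ∞ G]

/-- The real part of the `ħ⁰`-term of `μ`, as a map `M → 𝔤^*`. -/
noncomputable def reSymbol
    (μ : EnvHbar (GroupLieAlgebra 𝓘(ℝ, F) G) →ₗ[PowerSeries ℂ] PowerSeries (Smooth E M)) (x : M) :
    GroupLieAlgebra 𝓘(ℝ, F) G →L[ℝ] ℝ :=
  LinearMap.toContinuousLinearMap
    { toFun ξ := (symbol μ ξ x).re
      map_add' ξ η := by
        rw [symbol_add, ContMDiffMap.coe_add, Pi.add_apply, Complex.add_re]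
      map_smul' r ξ := by
        rw [symbol_smul, Complex.re_ofReal_mul]
        rfl }

/-- The imaginary part of the `ħ⁰`-term of `μ`, as a map `M → 𝔤^*`. -/
noncomputable def imSymbol
    (μ : EnvHbar (GroupLieAlgebra 𝓘(ℝ, F) G) →ₗ[PowerSeries ℂ] PowerSeries (Smooth E M)) (x : M) :
    GroupLieAlgebra 𝓘(ℝ, F) G →L[ℝ] ℝ :=
  LinearMap.toContinuousLinearMap
    { toFun ξ := (symbol μ ξ x).im
      map_add' ξ η := by
        rw [symbol_add, ContMDiffMap.coe_add, Pi.add_apply, Complex.add_im]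
      map_smul' r ξ := by
        rw [symbol_smul, Complex.im_ofReal_mul]
        rfl }

theorem reSymbol_apply
    (μ : EnvHbar (GroupLieAlgebra 𝓘(ℝ, F) G) →ₗ[PowerSeries ℂ] PowerSeries (Smooth E M)) (x : M)
    (ξ : GroupLieAlgebra 𝓘(ℝ, F) G) : reSymbol μ x ξ = (symbol μ ξ x).re := rfl

theorem imSymbol_apply
    (μ : EnvHbar (GroupLieAlgebra 𝓘(ℝ, F) G) →ₗ[PowerSeries ℂ] PowerSeries (Smooth E M)) (x : M)
    (ξ : GroupLieAlgebra 𝓘(ℝ, F) G) : imSymbol μ x ξ = (symbol μ ξ x).im := rfl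

variable [FiniteDimensional ℝ E] [IsManifold 𝓘(ℝ, E) ∞ M] [T2Space M] [MulAction G M]
  {Ω : SymplecticForm E M} {S : StarProduct Ω}
  {μ : EnvHbar (GroupLieAlgebra 𝓘(ℝ, F) G) →ₗ[PowerSeries ℂ] PowerSeries (Smooth E M)}

theorem IsQuantumMomentumMap.isMomentumMap (hμ : IsQuantumMomentumMap S μ) :
    IsMomentumMap Ω (reSymbol μ) where
  smooth ξ := contMDiff_re (symbol μ ξ)
  hamiltonian ξ x := Ω.eq_hamVec_re (symbol μ ξ) fun f => hμ.dComplex_infVec ξ f x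

theorem IsQuantumMomentumMap.dReal_imSymbol (hμ : IsQuantumMomentumMap S μ)
    (ξ : GroupLieAlgebra 𝓘(ℝ, F) G) (x : M) :
    dReal (E := E) (fun y => (symbol μ ξ y).im) x = 0 :=
  Ω.dReal_im_eq_zero (symbol μ ξ) fun f => hμ.dComplex_infVec ξ f x

theorem IsQuantumMomentumMap.isLocallyConstant_imSymbol (hμ : IsQuantumMomentumMap S μ) :
    IsLocallyConstant (imSymbol μ) := by
  have : IsManifold 𝓘(ℝ, E) 1 M := IsManifold.of_le (n := ∞) (by norm_cast)
  let b : Module.Basis _ ℝ (GroupLieAlgebra 𝓘(ℝ, F) G) :=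
    Module.finBasis ℝ (GroupLieAlgebra 𝓘(ℝ, F) G)
  have hb (i) : IsLocallyConstant fun x => imSymbol μ x (b i) := by
    refine isLocallyConstant_of_hasMFDerivAt_zero (E := E) fun x => ?_
    have h := ((contMDiff_im (symbol μ (b i))).mdifferentiable (by simp) x).hasMFDerivAt
    exact h.congr_mfderiv (hμ.dReal_imSymbol (b i) x)
  rw [IsLocallyConstant.iff_eventually_eq]
  intro x
  filter_upwards [Filter.eventually_all.2 fun i =>
    (IsLocallyConstant.iff_eventually_eq _).1 (hb i) x] with y hy
  exact ContinuousLinearMap.coe_injective (b.ext hy)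

/-- The leading terms satisfy `{a_ξ, a_η} = a_{[ξ, η]}`, and the left hand side is real because
`Im a_ξ` and `Im a_η` have zero differential. -/
theorem IsQuantumMomentumMap.symbol_lie (hμ : IsQuantumMomentumMap S μ)
    (ξ η : GroupLieAlgebra 𝓘(ℝ, F) G) (x : M) :
    symbol μ ⁅ξ, η⁆ x =
      (Ω.poissonReal (fun y => reSymbol μ y ξ) (fun y => reSymbol μ y η) x : ℝ) := by
  have hham : Ω.hamVec (fun y => (symbol μ ξ y).im) x = 0 := by
    rw [SymplecticForm.hamVec, hμ.dReal_imSymbol]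
    simp
  rw [← hμ.poisson_symbol, SymplecticForm.poisson, hham, map_zero, mul_zero, add_zero]
  apply Complex.ext
  · rw [dComplex_re]
    rfl
  · rw [dComplex_im, hμ.dReal_imSymbol]
    rfl

end ClassicalLimit

end QuantumMomentum

open QuantumMomentum
theorem mainTheorem11
    {E : Type*} [NormedAddCommGroup E] [NormedSpace ℝ E] [FiniteDimensional ℝ E]
    {M : Type*} [TopologicalSpace M] [ChartedSpace E M] [IsManifold 𝓘(ℝ, E) ∞ M]
    [T2Space M] [SecondCountableTopology M]
    {F : Type*} [NormedAddCommGroup F] [NormedSpace ℝ F] [FiniteDimensional ℝ F]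
    {G : Type*} [TopologicalSpace G] [ChartedSpace F G] [Group G] [LieGroup 𝓘(ℝ, F) ∞ G]
    [MulAction G M] [ContMDiffSMul 𝓘(ℝ, F) 𝓘(ℝ, E) ∞ G M]
    (Ω : SymplecticForm E M) (hΩ : IsSymplecticAction G Ω)
    (S : StarProduct Ω) (hS : IsEquivariantStar F G S)
    (μ : EnvHbar (GroupLieAlgebra 𝓘(ℝ, F) G) →ₗ[PowerSeries ℂ] PowerSeries (Smooth E M))
    (hμ : IsQuantumMomentumMap S μ) :
    ∃ J c : M → (GroupLieAlgebra 𝓘(ℝ, F) G →L[ℝ] ℝ),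
      IsMomentumMap Ω J ∧ IsEquivariantMap Ω J ∧
      -- the correction `c` is locally constant and vanishes on brackets
      IsLocallyConstant c ∧
      (∀ (x : M) (ξ η : GroupLieAlgebra 𝓘(ℝ, F) G), c x ⁅ξ, η⁆ = 0) ∧
      -- `c = 0` if the leading terms of all `μ(ξ)` are real-valued
      ((∀ (ξ : GroupLieAlgebra 𝓘(ℝ, F) G) (x : M),
        (PowerSeries.constantCoeff (μ (genU ξ)) x).im = 0) → c = 0) ∧
      -- `μ(f) = (J + i c)^* f + O(ħ)` for every polynomial `f` on `𝔤^*`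
      ∀ (n : ℕ) (b : Module.Basis (Fin n) ℝ (GroupLieAlgebra 𝓘(ℝ, F) G))
        (f : MvPolynomial (Fin n) ℂ) (x : M),
        PowerSeries.constantCoeff (μ (symmetrize b f)) x =
          MvPolynomial.eval (fun i => (J x (b i) : ℂ) + Complex.I * (c x (b i) : ℂ)) f := by
  refine ⟨reSymbol μ, imSymbol μ, hμ.isMomentumMap,
    hμ.isMomentumMap.isEquivariantMap fun ξ η x => ?_, hμ.isLocallyConstant_imSymbol,
    fun x ξ η => ?_, fun h => ?_, fun n b f x => ?_⟩
  · rw [reSymbol_apply, hμ.symbol_lie, Complex.ofReal_re]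
  · rw [imSymbol_apply, hμ.symbol_lie, Complex.ofReal_im]
  · funext x
    ext ξ
    exact h ξ x
  · rw [hμ.constantCoeff_symmetrize]
    congr 2
    funext i
    rw [reSymbol_apply, imSymbol_apply, mul_comm, Complex.re_add_im]
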